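/- **Setting.** Let $n=2$, let $d\in\mathbb N$, and fix a smoothness class $C^k$ with $k\ge 1$ (finite, $\infty$ or analytic); "diffeomorphism" means $C^k$-diffeomorphism. For a directed acyclic graph $G$ on $\{1,2\}$ write $\mathrm{pa}(i)$ for the parents and $\mathrm{nd}(i)$ for the non-descendants of $i$ (excluding $i$). A *latent model over $G$* consists of - base mechanisms $p_i(v_i\mid v_{\mathrm{pa}(i)})$ (conditional probability densities) and intervened mechanisms $\tilde p_i(v_i)$ (probability densities on $\mathbb R$), $i=1,2$; - three environments $e_0,e_1,e_2$ with intervention targets $\mathcal I^{e_0}=\varnothing$ and $\mathcal I^{e_i}=\{\sigma(i)\}$ for a permutation $\sigma$ of $\{1,2\}$, and the laws $P^{e}$ on $\mathbb R^2$ with densities $$p^{e}(v)=\prod_{i\in\mathcal I^{e}}\tilde p_i(v_i)\prod_{j\notin\mathcal I^{e}}p_j(v_j\mid v_{\mathrm{pa}(j)}),$$ such that every $p^{e}$ is continuously differentiable and strictly positive on $\mathbb R^2$, and $P^{e_0}$ is faithful to $G$: the only conditional independences among the coordinates that hold in $P^{e_0}$ are those implied by the relations $V_i\perp V_{\mathrm{nd}(i)}\mid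 V_{\mathrm{pa}(i)}$, $i=1,2$. **Ground truth.** Let $f:\mathbb R^2\to\mathbb R^d$ be a diffeomorphism onto its image $\mathcal X$. Let $(p_i,\tilde p_i,\sigma,P^{e})$ be a latent model over a graph $G$, and let $P^{e}_X=f_*P^{e}$ be the observed laws. Assume: - for $i=1,2$ and all $v\in\mathbb R^2$: $\displaystyle \frac{\partial}{\partial v_i}\,\frac{\tilde p_i(v_i)}{p_i(v_i\mid v_{\mathrm{pa}(i)})}\neq 0$; - (genericity) if $G$ has an edge $i\to j$, and $e$ is the environment with target $\{i\}$, then there is a continuous $\varphi:(0,\infty)\to\mathbb R$ such that both expectations below exist and $$\mathbb E_{v\sim P^{e_0}}\Big[\varphi\Big(\frac{\tilde p_j(v_j)}{p_j(v_j\mid v_i)}\Big)\Big]\neq \mathbb E_{v\sim P^{e}}\Big[\varphi\Big(\frac{\tilde p_j(v_j)}{p_j(v_j\mid v_i)}\Big)\Big].$$ **Candidate.** Let $h:\mathcal X\to\mathbb R^2$ be a bijection whose inverse $h^{-1}:\mathbb R^2\to\mathbb R^d$ is a diffeomorphism onto its image $\mathcal X$, and let $G'$ be a directed acyclic graph on $\{1,2\}$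 such that the laws $Q^{e}=h_*P^{e}_X$, $e\in\{e_0,e_1,e_2\}$, are the laws of some latent model over $G'$ (with its own mechanisms $q_i,\tilde q_i$ and its own, possibly different, target permutation). **Theorem.** Then $(f^{-1},G)\sim_{\mathrm{CRL}}(h,G')$: there are a permutation $\pi$ of $\{1,2\}$ with $i\to j$ in $G$ if and only if $\pi(i)\to\pi(j)$ in $G'$, and diffeomorphisms $\phi_1,\phi_2$ of $\mathbb R$, such that $h(x)_{\pi(i)}=\phi_i\big(f^{-1}(x)_i\big)$ for all $x\in\mathcal X$ and $i=1,2$. -/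

import Mathlib

open MeasureTheory ProbabilityTheory
open scoped Matrix Manifold ContDiff

namespace CRL

/-! ### Directed acyclic graphs and the conditional independences they encode -/

/-- `G` has no directed cycle (in particular no self-loop). -/
def IsAcyclic {n : ℕ} (G : Digraph (Fin n)) : Prop :=
  ∀ i, ¬ Relation.TransGen G.Adj i i

/-- The parents `pa(i)`. -/
def parents {n : ℕ} (G : Digraph (Fin n)) (i : Fin n) : Set (Fin n) := {j | G.Adj j i}

/-- The non-descendants `nd(i)`, a subset of the vertices other than `i`. -/
def nonDescendants {n : ℕ} (G : Digraph (Fin n)) (i : Fin n) : Set (Fin n) :=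
  {j | ¬ Relation.ReflTransGen G.Adj i j}

/-- The subvector `v_S` of `v`. -/
def sub {n : ℕ} (S : Set (Fin n)) (v : Fin n → ℝ) : S → ℝ := fun j => v j

lemma measurable_sub {n : ℕ} (S : Set (Fin n)) : Measurable (sub S) :=
  measurable_pi_lambda _ fun j => measurable_pi_apply (j : Fin n)

/-- `V_A ⫫ V_B | V_C` for a random vector `V` with law `μ`. -/
def CondIndepCoords {n : ℕ} (μ : Measure (Fin n → ℝ)) [IsFiniteMeasure μ]
    (A B C : Set (Fin n)) : Prop :=
  CondIndepFun (MeasurableSpace.comap (sub C) inferInstance) (measurable_sub C).comap_le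
    (sub A) (sub B) μ

/-- The relations `V_i ⫫ V_nd(i) | V_pa(i)` for all `i`. -/
def LocalMarkov {n : ℕ} (G : Digraph (Fin n)) (μ : Measure (Fin n → ℝ)) [IsFiniteMeasure μ] :
    Prop :=
  ∀ i, CondIndepCoords μ {i} (nonDescendants G i) (parents G i)

/-- Faithfulness: every (conditional) independence that holds in `μ` is implied by the relations
`V_i ⫫ V_nd(i) | V_pa(i)`, that is, it holds in every law that satisfies all of them. -/
def Faithful {n : ℕ} (G : Digraph (Fin n)) (μ : Measure (Fin n → ℝ)) [IsFiniteMeasure μ] : Prop :=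
  ∀ A B C : Set (Fin n), Disjoint A B → Disjoint A C → Disjoint B C →
    CondIndepCoords μ A B C →
      ∀ (ν : Measure (Fin n → ℝ)) [IsProbabilityMeasure ν], LocalMarkov G ν →
        CondIndepCoords ν A B C

/-! ### Mechanisms, interventions and environments -/

/-- Base mechanisms: `p i x w` stands for `p_i(v_i = x | v_pa(i) = w)`. -/
abbrev Mechanisms {n : ℕ} (G : Digraph (Fin n)) : Type :=
  (i : Fin n) → ℝ → (parents G i → ℝ) → ℝ

/-- `r x w` is a conditional probability density in `x` given `w`. -/
structure IsCondDensity {ι : Type*} (r : ℝ → (ι → ℝ) → ℝ) : Prop where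
  measurable : Measurable (Function.uncurry r)
  nonneg : ∀ x w, 0 ≤ r x w
  lintegral_eq_one : ∀ w, ∫⁻ x, ENNReal.ofReal (r x w) = 1

/-- `r` is a probability density on `ℝ`. -/
structure IsDensity (r : ℝ → ℝ) : Prop where
  measurable : Measurable r
  nonneg : ∀ x, 0 ≤ r x
  lintegral_eq_one : ∫⁻ x, ENNReal.ofReal (r x) = 1

open Classical in
/-- The joint density obtained from the base mechanisms `p` by a perfect intervention on the nodes
in `I`, where each `p_i(v_i | v_pa(i))` with `i ∈ I` is replaced by `pt i (v_i)`. -/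
noncomputable def jointDensity {n : ℕ} (G : Digraph (Fin n)) (p : Mechanisms G)
    (pt : Fin n → ℝ → ℝ) (I : Set (Fin n)) (v : Fin n → ℝ) : ℝ :=
  ∏ i, if i ∈ I then pt i (v i) else p i (v i) (sub (parents G i) v)

/-- Intervention targets of the environments `e_0, …, e_n`: none in the observational environment
`e_0`, and the single node `σ i` in the `i`-th interventional environment. -/
def targets {n : ℕ} (σ : Equiv.Perm (Fin n)) : Fin (n + 1) → Set (Fin n) :=
  Fin.cases ∅ fun i => {σ i}

/-- The environment in which node `i` is intervened upon. -/
def envOf {n : ℕ} (σ : Equiv.Perm (Fin n)) (i : Fin n) : Fin (n + 1) := (σ.symm i).succ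

/-- The laws `P e` of the latent vector in the environments `e_0, …, e_n` arise from the causal
graph `G` with base mechanisms `p` by one perfect single-node intervention per node, with
intervened mechanisms `pt` and targets given by `σ`; all joint densities are `C¹` and positive, and
the observational law is faithful to `G`. -/
structure IsLatentModel {n : ℕ} (G : Digraph (Fin n)) (p : Mechanisms G) (pt : Fin n → ℝ → ℝ)
    (σ : Equiv.Perm (Fin n)) (P : Fin (n + 1) → Measure (Fin n → ℝ))
    [∀ e, IsProbabilityMeasure (P e)] : Prop where
  acyclic : IsAcyclic G
  base_density : ∀ i, IsCondDensity (p i)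
  intervened_density : ∀ i, IsDensity (pt i)
  law : ∀ e, P e =
    volume.withDensity fun v => ENNReal.ofReal (jointDensity G p pt (targets σ e) v)
  contDiff : ∀ e, ContDiff ℝ 1 (jointDensity G p pt (targets σ e))
  pos : ∀ e v, 0 < jointDensity G p pt (targets σ e) v
  faithful : Faithful G (P 0)

/-- Intervened and base mechanisms differ everywhere: the derivative of
`pt_i(v_i) / p_i(v_i | v_pa(i))` in `v_i` vanishes nowhere. -/
def MechanismsDiffer {n : ℕ} (G : Digraph (Fin n)) (p : Mechanisms G) (pt : Fin n → ℝ → ℝ) :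
    Prop :=
  ∀ (i : Fin n) (x : ℝ) (w : parents G i → ℝ), deriv (fun y => pt i y / p i y w) x ≠ 0

/-- Genericity: for each edge `i → j`, the expectations of some continuous function
`φ : (0, ∞) → ℝ` of `pt_j(v_j) / p_j(v_j | v_pa(j))` in the observational environment and in the
environment with an intervention on `i` exist and differ. -/
def Generic {n : ℕ} (G : Digraph (Fin n)) (p : Mechanisms G) (pt : Fin n → ℝ → ℝ)
    (σ : Equiv.Perm (Fin n)) (P : Fin (n + 1) → Measure (Fin n → ℝ)) : Prop :=
  ∀ i j, G.Adj i j → ∃ φ : ℝ → ℝ, ContinuousOn φ (Set.Ioi 0) ∧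
    Integrable (fun v => φ (pt j (v j) / p j (v j) (sub (parents G j) v))) (P 0) ∧
    Integrable (fun v => φ (pt j (v j) / p j (v j) (sub (parents G j) v))) (P (envOf σ i)) ∧
    ∫ v, φ (pt j (v j) / p j (v j) (sub (parents G j) v)) ∂(P 0) ≠
      ∫ v, φ (pt j (v j) / p j (v j) (sub (parents G j) v)) ∂(P (envOf σ i))

/-! ### Mixing functions and the identifiability class -/

/-- `f : ℝⁿ → ℝᵈ` is a `C^k` diffeomorphism onto its image, and `g` is its inverse there (the values
of `g` off the image are irrelevant). -/
structure IsDiffeoOntoImage {n d : ℕ} (k : ℕ∞ω) (f : (Fin n → ℝ) → Fin d → ℝ)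
    (g : (Fin d → ℝ) → Fin n → ℝ) : Prop where
  contDiff : ContDiff ℝ k f
  contDiffOn_inv : ContDiffOn ℝ k g (Set.range f)
  leftInverse : Function.LeftInverse g f

/-- `(h₁, G₁) ∼_CRL (h₂, G₂)` for unmixing functions on `X ⊆ ℝᵈ`:
`h₂ = P_{π⁻¹} ∘ φ ∘ h₁` on `X` for an element-wise `C^k` diffeomorphism `φ` and a permutation `π`
that is a graph isomorphism from `G₁` to `G₂`. Here `(P_{π⁻¹} y)_{π(i)} = y_i`. -/
def CRLEquiv {n d : ℕ} (k : ℕ∞ω) (X : Set (Fin d → ℝ))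
    (h₁ : (Fin d → ℝ) → Fin n → ℝ) (G₁ : Digraph (Fin n))
    (h₂ : (Fin d → ℝ) → Fin n → ℝ) (G₂ : Digraph (Fin n)) : Prop :=
  ∃ (π : Equiv.Perm (Fin n)) (φ : Fin n → Diffeomorph 𝓘(ℝ, ℝ) 𝓘(ℝ, ℝ) ℝ ℝ k),
    (∀ x ∈ X, h₂ x = (π⁻¹).permMatrix ℝ *ᵥ fun i => φ i (h₁ x i)) ∧
    ∀ i j, G₁.Adj i j ↔ G₂.Adj (π i) (π j)

end CRL

namespace CRL

/-! Write `Ψ = h ∘ f`, a diffeomorphism of the plane carrying each `P e` to `Q e`, and `ρ = τ ∘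
σ⁻¹`, which pairs the nodes targeted in the same environment. It suffices that `Ψ` acts
coordinatewise along `ρ` and that `ρ` respects edges.

Dividing an interventional density by the observational one leaves `pt_i / p_i`, and such a ratio is
invariant under `Ψ` (`densityRatio_comp`). If `i` and `ρ i` are both roots, the ratio is a function
of `v_i` alone and of `Ψ_{ρ i}` alone. Its derivative in `v_i` never vanishes, so these two
coordinates determine each other (`coord_eq_iff_coord_eq`).

For the other node `j`, the intervention on `j` makes both pairs of coordinates independent. Hence
`Ψ_{ρ j}` is independent of `v_i`: for every value of `v_i`, the injective map `v_j ↦ Ψ_{ρ j}`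
transports the same law to the same law. A monotone transport of given orientation is unique, and
the orientation cannot flip continuously, so `Ψ_{ρ j}` ignores `v_i` (`eq_of_indepFun`).

A matched pair of roots exists (`exists_isRoot_isRoot`): otherwise the edges are `i → j` and `ρ j →
ρ i`, and the ratio at `j` is a function of the root coordinate `ρ j`, whose law is unaffected by
intervening on `ρ i`, against genericity. Finally, an edge is the same as observational dependence,
which coordinatewise maps preserve. -/

/-! ### Planar vectors with a distinguished coordinate -/

/-- The vector in `ℝ²` with `i`-th coordinate `x` and other coordinate `y`. -/
def planeVec (i : Fin 2) (x y : ℝ) : Fin 2 → ℝ := fun m => if m = i then x else y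

@[simp] lemma planeVec_self (i : Fin 2) (x y : ℝ) : planeVec i x y i = x := if_pos rfl

lemma planeVec_of_ne {i j : Fin 2} (hij : i ≠ j) (x y : ℝ) : planeVec i x y j = y :=
  if_neg hij.symm

lemma eq_or_eq_of_ne {i j : Fin 2} (hij : i ≠ j) (m : Fin 2) : m = i ∨ m = j := by omega

lemma planeVec_eta {i j : Fin 2} (hij : i ≠ j) (v : Fin 2 → ℝ) :
    planeVec i (v i) (v j) = v := by
  ext m
  rcases eq_or_eq_of_ne hij m with rfl | rfl
  · simp
  · rw [planeVec_of_ne hij]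

lemma contDiff_planeVec (i : Fin 2) {k : WithTop ℕ∞} :
    ContDiff ℝ k fun z : ℝ × ℝ => planeVec i z.1 z.2 := by
  rw [contDiff_pi]
  intro m
  by_cases hm : m = i
  · simpa [planeVec, hm] using contDiff_fst
  · simpa [planeVec, hm] using contDiff_snd

lemma continuous_planeVec (i : Fin 2) :
    Continuous fun z : ℝ × ℝ => planeVec i z.1 z.2 :=
  (contDiff_planeVec i (k := 0)).continuous

lemma lintegral_planeVec (i : Fin 2) {F : (Fin 2 → ℝ) → ENNReal} (hF : Measurable F) :
    ∫⁻ v, F v = ∫⁻ x, ∫⁻ y, F (planeVec i x y) := by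
  have h1 : ∫⁻ v, F v = ∫⁻ z : ℝ × ℝ, F (MeasurableEquiv.finTwoArrow.symm z) :=
    ((volume_preserving_finTwoArrow ℝ).symm.lintegral_comp hF).symm
  have hm : Measurable fun z : ℝ × ℝ => F (MeasurableEquiv.finTwoArrow.symm z) :=
    hF.comp (MeasurableEquiv.measurable _)
  have e0 (x y : ℝ) : MeasurableEquiv.finTwoArrow.symm (x, y) = planeVec 0 x y := by
    ext m
    fin_cases m <;> simp [planeVec, MeasurableEquiv.finTwoArrow]
  have e1 (x y : ℝ) : MeasurableEquiv.finTwoArrow.symm (x, y) = planeVec 1 y x := by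
    ext m
    fin_cases m <;> simp [planeVec, MeasurableEquiv.finTwoArrow]
  rw [h1, Measure.volume_eq_prod]
  fin_cases i
  · rw [lintegral_prod _ hm.aemeasurable]
    simp [e0]
  · rw [lintegral_prod_symm _ hm.aemeasurable]
    simp [e1]

/-! ### Independence -/

lemma indepFun_map_iff {Ω Ω' β γ : Type*} [MeasurableSpace Ω] [MeasurableSpace Ω']
    [MeasurableSpace β] [MeasurableSpace γ] {μ : Measure Ω} {T : Ω → Ω'} (hT : Measurable T)
    {X : Ω' → β} {Y : Ω' → γ} (hX : Measurable X) (hY : Measurable Y) :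
    IndepFun X Y (μ.map T) ↔ IndepFun (X ∘ T) (Y ∘ T) μ := by
  simp only [indepFun_iff_measure_inter_preimage_eq_mul, Set.preimage_comp, ← Set.preimage_inter]
  refine forall₄_congr fun s t hs ht => ?_
  rw [Measure.map_apply hT ((hX hs).inter (hY ht)), Measure.map_apply hT (hX hs),
    Measure.map_apply hT (hY ht)]

/-- A density that factorizes over the two coordinates makes them independent. -/
lemma indepFun_of_factorization {i j : Fin 2} (hij : i ≠ j) {D : (Fin 2 → ℝ) → ℝ}
    {a b : ℝ → ℝ} (ha : IsDensity a) (hb : IsDensity b) (hD : ∀ v, D v = a (v i) * b (v j)) :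
    IndepFun (fun v : Fin 2 → ℝ => v i) (fun v => v j)
      (volume.withDensity fun v => ENNReal.ofReal (D v)) := by
  have ha' := ha.measurable.ennreal_ofReal
  have hb' := hb.measurable.ennreal_ofReal
  have hDm : Measurable fun v => ENNReal.ofReal (D v) := by
    simp only [hD]
    exact ((ha.measurable.comp (measurable_pi_apply i)).mul
      (hb.measurable.comp (measurable_pi_apply j))).ennreal_ofReal
  have key : ∀ s t : Set ℝ, MeasurableSet s → MeasurableSet t →
      (volume.withDensity fun v => ENNReal.ofReal (D v))
        ((fun v : Fin 2 → ℝ => v i) ⁻¹' s ∩ (fun v => v j) ⁻¹' t) =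
      (∫⁻ x in s, ENNReal.ofReal (a x)) * ∫⁻ y in t, ENNReal.ofReal (b y) := by
    intro s t hs ht
    have hst := (measurable_pi_apply (X := fun _ : Fin 2 => ℝ) i hs).inter
      (measurable_pi_apply (X := fun _ : Fin 2 => ℝ) j ht)
    change (volume.withDensity fun v => ENNReal.ofReal (D v))
      (Function.eval i ⁻¹' s ∩ Function.eval j ⁻¹' t) = _
    rw [withDensity_apply _ hst, ← lintegral_indicator hst,
      lintegral_planeVec i (hDm.indicator hst), ← lintegral_indicator hs,
      ← lintegral_indicator ht, ← lintegral_mul_const _ (ha'.indicator hs)]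
    refine lintegral_congr fun x => ?_
    rw [← lintegral_const_mul _ (hb'.indicator ht)]
    refine lintegral_congr fun y => ?_
    by_cases hx : x ∈ s <;> by_cases hy : y ∈ t <;>
      simp [Set.indicator, hx, hy, planeVec_of_ne hij, hD, ENNReal.ofReal_mul (ha.nonneg x)]
  rw [indepFun_iff_measure_inter_preimage_eq_mul]
  intro s t hs ht
  have k1 := key s Set.univ hs .univ
  have k2 := key Set.univ t .univ ht
  rw [Set.preimage_univ, Set.inter_univ, Measure.restrict_univ, hb.lintegral_eq_one, mul_one] at k1
  rw [Set.preimage_univ, Set.univ_inter, Measure.restrict_univ, ha.lintegral_eq_one, one_mul] at k2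
  rw [key s t hs ht, k1, k2]

/-- The marginal law of a coordinate whose density factor can be split off. -/
lemma map_eval_of_factorization (i : Fin 2) {D : (Fin 2 → ℝ) → ℝ} {a : ℝ → ℝ} {c : ℝ → ℝ → ℝ}
    (hDm : Measurable D) (ha : IsDensity a) (hc : ∀ x, ∫⁻ y, ENNReal.ofReal (c x y) = 1)
    (hcm : ∀ x, Measurable (c x)) (hD : ∀ x y, D (planeVec i x y) = a x * c x y) :
    (volume.withDensity fun v => ENNReal.ofReal (D v)).map (fun v : Fin 2 → ℝ => v i) =
      volume.withDensity fun x => ENNReal.ofReal (a x) := by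
  ext s hs
  have hs' := measurable_pi_apply (X := fun _ : Fin 2 => ℝ) i hs
  rw [Measure.map_apply (measurable_pi_apply i) hs, withDensity_apply _ hs]
  change (volume.withDensity fun v => ENNReal.ofReal (D v)) (Function.eval i ⁻¹' s) = _
  rw [withDensity_apply _ hs', ← lintegral_indicator hs',
    lintegral_planeVec i (hDm.ennreal_ofReal.indicator hs'), ← lintegral_indicator hs]
  refine lintegral_congr fun x => ?_
  by_cases hx : x ∈ s
  · simp [Set.indicator, hx, hD, ENNReal.ofReal_mul (ha.nonneg x),
      lintegral_const_mul _ (hcm x).ennreal_ofReal, hc]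
  · simp [Set.indicator, hx]

/-! ### Rigidity of transports -/

/-- If two continuous strictly monotone maps of the same orientation give their sublevel sets the
same measure, the second is at most the first; by symmetry, they agree. -/
lemma le_of_measure_sublevel_eq {ν : Measure ℝ} [IsFiniteMeasure ν] [ν.IsOpenPosMeasure]
    {g₁ g₂ : ℝ → ℝ} (h₁ : Continuous g₁) (h₂ : Continuous g₂)
    (hmono : (StrictMono g₁ ∧ StrictMono g₂) ∨ (StrictAnti g₁ ∧ StrictAnti g₂))
    (hν : ∀ c, ν {y | g₁ y ≤ c} = ν {y | g₂ y ≤ c}) (y : ℝ) : g₂ y ≤ g₁ y := by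
  by_contra! hlt
  have hopen : IsOpen {t | g₁ t < g₂ y} := isOpen_lt h₁ continuous_const
  have hsub : {t | g₂ t ≤ g₂ y} ⊆ {t | g₁ t ≤ g₂ y} := by
    intro t ht
    rcases hmono with ⟨m₁, m₂⟩ | ⟨m₁, m₂⟩
    · exact (m₁.monotone (m₂.le_iff_le.1 ht)).trans hlt.le
    · exact (m₁.antitone (m₂.le_iff_ge.1 ht)).trans hlt.le
  obtain ⟨ε, hε, hball⟩ := Metric.isOpen_iff.1 hopen y hlt
  -- On one side of `y`, `g₂` exceeds `g₂ y` while `g₁` is still below it. The difference of the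
  -- sublevel sets thus contains a nonempty open set, although equal measures make it null.
  have hgap : ∃ t, t ∈ Metric.ball y ε ∧ g₂ y < g₂ t := by
    rcases hmono with ⟨-, m₂⟩ | ⟨-, m₂⟩
    · exact ⟨y + ε / 2, by simp [abs_of_pos hε, hε], m₂ (by linarith)⟩
    · exact ⟨y - ε / 2, by simp [abs_of_pos hε, hε], m₂ (by linarith)⟩
  obtain ⟨t, ht, hgt⟩ := hgap
  have hpos : 0 < ν ({t | g₁ t < g₂ y} ∩ {t | g₂ y < g₂ t}) :=
    (hopen.inter (isOpen_lt continuous_const h₂)).measure_pos ν ⟨t, hball ht, hgt⟩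
  have hdiff : ν ({t | g₁ t ≤ g₂ y} \ {t | g₂ t ≤ g₂ y}) = 0 := by
    rw [measure_sdiff hsub (measurableSet_le h₂.measurable measurable_const).nullMeasurableSet
      (measure_ne_top _ _), hν, tsub_self]
  refine hpos.ne' (measure_mono_null ?_ hdiff)
  rintro s ⟨hs₁ : g₁ s < g₂ y, hs₂ : g₂ y < g₂ s⟩
  exact ⟨hs₁.le, hs₂.not_ge⟩

/-- A continuous family of continuous injective maps `ℝ → ℝ` that transport a fixed
measure of full support to a fixed law is constant. -/
lemma eq_of_measure_sublevel_eq {ν : Measure ℝ} [IsFiniteMeasure ν] [ν.IsOpenPosMeasure]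
    {g : ℝ → ℝ → ℝ} (hg : Continuous (Function.uncurry g)) (hinj : ∀ x, Function.Injective (g x))
    (hν : ∀ x u c, ν {y | g x y ≤ c} = ν {y | g u y ≤ c}) (x u : ℝ) : g x = g u := by
  have hgx (x : ℝ) : Continuous (g x) := hg.comp (Continuous.prodMk_right x)
  have hgy (y : ℝ) : Continuous fun x => g x y := hg.comp (Continuous.prodMk_left y)
  have hmono (x : ℝ) := (hgx x).strictMono_of_inj (hinj x)
  -- By the intermediate value theorem in `x`, a change of orientation would force `g z 0 = g z 1`
  -- for some `z`.
  have hsign : ∀ x u, g x 0 < g x 1 → ¬ g u 1 < g u 0 := by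
    intro x u h h'
    obtain ⟨z, hz⟩ : ∃ z, g z 0 - g z 1 = 0 :=
      mem_range_of_exists_le_of_exists_ge (f := fun x => g x 0 - g x 1)
        ((hgy 0).sub (hgy 1)) ⟨x, by linarith⟩ ⟨u, by linarith⟩
    exact zero_ne_one (hinj z (sub_eq_zero.1 hz))
  have horient (x u : ℝ) :
      (StrictMono (g x) ∧ StrictMono (g u)) ∨ (StrictAnti (g x) ∧ StrictAnti (g u)) := by
    rcases hmono x with h | h <;> rcases hmono u with h' | h'
    · exact Or.inl ⟨h, h'⟩
    · exact absurd (h' zero_lt_one) (hsign x u (h zero_lt_one))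
    · exact absurd (h zero_lt_one) (hsign u x (h' zero_lt_one))
    · exact Or.inr ⟨h, h'⟩
  ext y
  exact le_antisymm
    (le_of_measure_sublevel_eq (hgx u) (hgx x) (horient u x) (hν u x) y)
    (le_of_measure_sublevel_eq (hgx x) (hgx u) (horient x u) (hν x u) y)

/-- The measure of a sublevel set of a continuous family of injective functions is continuous. -/
lemma continuous_measure_sublevel {ν : Measure ℝ} [IsFiniteMeasure ν] [NullSingletonClass ν]
    {g : ℝ → ℝ → ℝ} (hg : Continuous (Function.uncurry g)) (hinj : ∀ x, Function.Injective (g x))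
    (c : ℝ) : Continuous fun x => ν {y | g x y ≤ c} := by
  have hgx (x : ℝ) : Continuous (g x) := hg.comp (Continuous.prodMk_right x)
  have hgy (y : ℝ) : Continuous fun x => g x y := hg.comp (Continuous.prodMk_left y)
  refine continuous_iff_continuousAt.2 fun x => ?_
  refine tendsto_measure_of_ae_tendsto_indicator_of_isFiniteMeasure (nhds x)
    (measurableSet_le (hgx x).measurable measurable_const)
    (fun z => measurableSet_le (hgx z).measurable measurable_const) ?_
  have hnull : ν {y | g x y = c} = 0 :=
    Set.Subsingleton.measure_zero (fun y hy y' hy' => hinj x (hy.trans hy'.symm)) ν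
  have hne : ∀ᵐ y ∂ν, g x y ≠ c := measure_eq_zero_iff_ae_notMem.1 hnull
  filter_upwards [hne] with y hy
  rcases hy.lt_or_gt with h | h
  · filter_upwards [(hgy y).continuousAt.eventually_lt_const h] with z hz
    exact iff_of_true hz.le h.le
  · filter_upwards [(hgy y).continuousAt.eventually_const_lt h] with z hz
    exact iff_of_false (not_le.2 hz) (not_le.2 h)

/-- If the coordinates `v_i, v_j` are independent, `F` is independent of `v_i`, and `F` is injective
in `v_j`, then `F` does not depend on `v_i`. -/
lemma eq_of_indepFun {μ : Measure (Fin 2 → ℝ)} [IsProbabilityMeasure μ]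
    (hac : μ ≪ volume) (hac' : volume ≪ μ) {i j : Fin 2} (hij : i ≠ j)
    (hind : IndepFun (fun v : Fin 2 → ℝ => v i) (fun v => v j) μ)
    {F : (Fin 2 → ℝ) → ℝ} (hF : Continuous F)
    (hindF : IndepFun (fun v : Fin 2 → ℝ => v i) F μ)
    (hinj : ∀ x, Function.Injective fun y => F (planeVec i x y)) (x x' y : ℝ) :
    F (planeVec i x y) = F (planeVec i x' y) := by
  have hmi : Measurable fun v : Fin 2 → ℝ => v i := measurable_pi_apply i
  have hmj : Measurable fun v : Fin 2 → ℝ => v j := measurable_pi_apply j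
  have hopen (m : Fin 2) : (μ.map fun v => v m).IsOpenPosMeasure := by
    refine ⟨fun U hU hne => ?_⟩
    rw [Measure.map_apply (measurable_pi_apply m) hU.measurableSet]
    intro h0
    obtain ⟨u, hu⟩ := hne
    exact (hU.preimage (continuous_apply m)).measure_ne_zero volume ⟨fun _ => u, hu⟩ (hac' h0)
  have := hopen i
  have := hopen j
  have hatom : NullSingletonClass (μ.map fun v => v j) := by
    refine ⟨fun t => ?_⟩
    rw [Measure.map_apply hmj (measurableSet_singleton t)]
    exact hac ((Measure.quasiMeasurePreserving_eval (fun _ => (volume : Measure ℝ)) j).preimage_null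
      (measure_singleton t))
  have := Measure.isProbabilityMeasure_map (μ := μ) hmi.aemeasurable
  have := Measure.isProbabilityMeasure_map (μ := μ) hmj.aemeasurable
  have hprod := (indepFun_iff_map_prod_eq_prod_map_map hmi.aemeasurable hmj.aemeasurable).1 hind
  have hg : Continuous (Function.uncurry fun x y => F (planeVec i x y)) :=
    hF.comp (continuous_planeVec i)
  refine congrFun (eq_of_measure_sublevel_eq (ν := μ.map fun v => v j) hg hinj ?_ x x') y
  suffices h : ∀ c x, (μ.map fun v => v j) {y | F (planeVec i x y) ≤ c} = μ {v | F v ≤ c} from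
    fun x x' c => (h c x).trans (h c x').symm
  intro c
  -- Both sides are continuous in `x` and the law of `v i` has full support, so equality for almost
  -- every `x` suffices; this is tested by integrating over sets `A`.
  refine fun x => congrFun (((continuous_measure_sublevel hg hinj c).ae_eq_iff_eq
    (μ.map fun v => v i) continuous_const).1 ?_) x
  have hS : MeasurableSet {z : ℝ × ℝ | F (planeVec i z.1 z.2) ≤ c} :=
    measurableSet_le hg.measurable measurable_const
  refine ae_eq_of_forall_setLIntegral_eq_of_sigmaFinite
    (measurable_measure_prodMk_left hS) measurable_const fun A hA _ => ?_
  have hAS := (hA.prod MeasurableSet.univ).inter hS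
  have hpre : (fun v : Fin 2 → ℝ => (v i, v j)) ⁻¹'
      (A ×ˢ Set.univ ∩ {z : ℝ × ℝ | F (planeVec i z.1 z.2) ≤ c}) =
        (fun v : Fin 2 → ℝ => v i) ⁻¹' A ∩ F ⁻¹' Set.Iic c := by
    ext v
    simp [planeVec_eta hij]
  have hmeas := congrArg (fun M : Measure (ℝ × ℝ) =>
    M (A ×ˢ Set.univ ∩ {z : ℝ × ℝ | F (planeVec i z.1 z.2) ≤ c})) hprod
  simp only [Measure.map_apply (hmi.prodMk hmj) hAS, hpre, Measure.prod_apply hAS] at hmeas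
  rw [hindF.measure_inter_preimage_eq_mul _ _ hA measurableSet_Iic,
    ← Measure.map_apply hmi hA] at hmeas
  rw [setLIntegral_const, mul_comm]
  refine Eq.trans ?_ hmeas.symm
  rw [← lintegral_indicator hA]
  refine lintegral_congr fun x => ?_
  by_cases hx : x ∈ A <;> simp [Set.indicator, hx, Set.preimage, Set.inter_def]

/-! ### Independence relations encoded by a graph -/

/-- The conditioning σ-algebra is trivial, so the conditional expectations are constants. -/
lemma condIndepCoords_empty_iff {n : ℕ} (μ : Measure (Fin n → ℝ)) [IsProbabilityMeasure μ]
    (A B : Set (Fin n)) : CondIndepCoords μ A B ∅ ↔ IndepFun (sub A) (sub B) μ := by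
  have hbot : MeasurableSpace.comap (sub (∅ : Set (Fin n))) inferInstance =
      (⊥ : MeasurableSpace (Fin n → ℝ)) := by
    rw [Subsingleton.elim (sub (∅ : Set (Fin n))) fun _ => 0, MeasurableSpace.comap_const]
  rw [CondIndepCoords, condIndepFun_iff_condExp_inter_preimage_eq_mul (measurable_sub A)
    (measurable_sub B), indepFun_iff_measure_inter_preimage_eq_mul]
  refine forall₄_congr fun s t hs ht => ?_
  have hs' := measurable_sub A hs
  have ht' := measurable_sub B ht
  rw [hbot, condExp_bot, condExp_bot, condExp_bot]
  simp only [integral_indicator, hs', ht', hs'.inter ht', integral_const, smul_eq_mul, mul_one,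
    measureReal_restrict_apply_univ]
  have hconst (a b : ℝ) : (fun _ : Fin n → ℝ => a) =ᵐ[μ] (fun _ => b) ↔ a = b :=
    ⟨fun h => by simpa using h.exists.choose_spec, fun h => by rw [h]⟩
  refine (hconst _ _).trans ?_
  rw [measureReal_def, measureReal_def, measureReal_def, ← ENNReal.toReal_mul,
    ENNReal.toReal_eq_toReal_iff' (by finiteness) (by finiteness)]

/-- Given `V_C`, the vector `V_B` is already known. -/
lemma condIndepCoords_of_subset {n : ℕ} (μ : Measure (Fin n → ℝ)) [IsFiniteMeasure μ]
    {A B C : Set (Fin n)} (h : B ⊆ C) : CondIndepCoords μ A B C := by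
  refine condIndepFun_of_measurable_right (measurable_sub A) ?_
  have : sub B = (fun w (b : B) => w ⟨b, h b.2⟩) ∘ sub C := rfl
  rw [this]
  exact (measurable_pi_lambda _ fun b => measurable_pi_apply _).comp (comap_measurable _)

lemma indepFun_sub_singleton_iff {n : ℕ} {μ : Measure (Fin n → ℝ)} (i j : Fin n) :
    IndepFun (sub {i}) (sub {j}) μ ↔
      IndepFun (fun v : Fin n → ℝ => v i) (fun v => v j) μ := by
  constructor <;> intro h
  · exact h.comp (φ := fun w => w ⟨i, rfl⟩) (ψ := fun w => w ⟨j, rfl⟩)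
      (measurable_pi_apply (X := fun _ : ({i} : Set (Fin n)) => ℝ) ⟨i, rfl⟩)
      (measurable_pi_apply (X := fun _ : ({j} : Set (Fin n)) => ℝ) ⟨j, rfl⟩)
  · have hsub (m : Fin n) : sub {m} = (fun t _ => t) ∘ fun v : Fin n → ℝ => v m := by
      ext v ⟨l, rfl⟩
      rfl
    rw [hsub, hsub]
    exact h.comp (measurable_pi_lambda _ fun _ => measurable_id)
      (measurable_pi_lambda _ fun _ => measurable_id)

/-- A fair coin copied to all coordinates. -/
noncomputable def copiedCoin (n : ℕ) : Measure (Fin n → ℝ) :=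
  (2⁻¹ : ENNReal) • Measure.dirac (fun _ => 0) + (2⁻¹ : ENNReal) • Measure.dirac (fun _ => 1)

instance (n : ℕ) : IsProbabilityMeasure (copiedCoin n) :=
  ⟨by simp [copiedCoin, ENNReal.inv_two_add_inv_two]⟩

/-- Both coordinates vanish with probability 1/2, not 1/4. -/
lemma not_indepFun_copiedCoin {n : ℕ} (i j : Fin n) :
    ¬ IndepFun (fun v : Fin n → ℝ => v i) (fun v => v j) (copiedCoin n) := by
  intro h
  have h0 : MeasurableSet ({0} : Set ℝ) := measurableSet_singleton 0
  have hs (m : Fin n) : MeasurableSet ((fun v : Fin n → ℝ => v m) ⁻¹' {0}) :=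
    measurable_pi_apply m h0
  have := h.measure_inter_preimage_eq_mul _ _ h0 h0
  simp [copiedCoin, hs, (hs i).inter (hs j)] at this
  have := congrArg ENNReal.toReal this
  norm_num at this

lemma ne_of_adj {n : ℕ} {G : Digraph (Fin n)} (hG : IsAcyclic G) {i j : Fin n} (h : G.Adj i j) :
    i ≠ j := by
  rintro rfl
  exact hG i (.single h)

/-- In a faithful law, adjacent nodes are dependent. -/
lemma Faithful.not_indepFun {G : Digraph (Fin 2)} (hG : IsAcyclic G) {μ : Measure (Fin 2 → ℝ)}
    [IsProbabilityMeasure μ] (hμ : Faithful G μ) {i j : Fin 2} (hadj : G.Adj i j) :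
    ¬ IndepFun (fun v : Fin 2 → ℝ => v i) (fun v => v j) μ := by
  intro hind
  have hij := ne_of_adj hG hadj
  -- With an edge present, the non-descendants of each node are among its parents, so the local
  -- Markov relations hold in every law, even for the copied coin.
  have hmarkov : LocalMarkov G (copiedCoin 2) := by
    intro m
    refine condIndepCoords_of_subset _ fun l hl => ?_
    rcases eq_or_eq_of_ne hij m with rfl | rfl <;> rcases eq_or_eq_of_ne hij l with rfl | rfl
    · exact absurd .refl hl
    · exact absurd (.single hadj) hl
    · exact hadj
    · exact absurd .refl hl
  have := hμ {i} {j} ∅ (by simpa using hij) (by simp) (by simp)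
    ((condIndepCoords_empty_iff _ _ _).2 ((indepFun_sub_singleton_iff i j).2 hind)) _ hmarkov
  exact not_indepFun_copiedCoin i j
    ((indepFun_sub_singleton_iff i j).1 ((condIndepCoords_empty_iff _ _ _).1 this))

/-! ### Root nodes of latent models -/

/-- `i` has no parents. -/
def IsRoot {n : ℕ} (G : Digraph (Fin n)) (i : Fin n) : Prop := ∀ m, ¬ G.Adj m i

lemma isRoot_or_adj {G : Digraph (Fin 2)} (hG : IsAcyclic G) {i j : Fin 2} (hij : i ≠ j) :
    IsRoot G i ∨ G.Adj j i := by
  by_cases h : G.Adj j i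
  · exact .inr h
  · refine .inl fun m hm => ?_
    rcases eq_or_eq_of_ne hij m with rfl | rfl
    · exact ne_of_adj hG hm rfl
    · exact h hm

lemma isRoot_of_adj {G : Digraph (Fin 2)} (hG : IsAcyclic G) {i j : Fin 2} (h : G.Adj i j) :
    IsRoot G i :=
  (isRoot_or_adj hG (ne_of_adj hG h)).resolve_right fun h' => hG i (.tail (.single h) h')

/-- The parent argument of a root is vacuous, so `sub _ 0` can stand for it everywhere. -/
lemma IsRoot.sub_eq {n : ℕ} {G : Digraph (Fin n)} {i : Fin n} (hi : IsRoot G i)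
    (w w' : parents G i → ℝ) : w = w' :=
  funext fun m => absurd m.2 (hi m)

open Classical in
/-- The density of the root node `i` under an intervention on `I`. -/
noncomputable def rootDensity {n : ℕ} (G : Digraph (Fin n)) (p : Mechanisms G)
    (pt : Fin n → ℝ → ℝ) (I : Set (Fin n)) (i : Fin n) : ℝ → ℝ :=
  if i ∈ I then pt i else fun x => p i x (sub _ 0)

open Classical in
lemma jointDensity_eq_mul {G : Digraph (Fin 2)} {i j : Fin 2} (hij : i ≠ j) (p : Mechanisms G)
    (pt : Fin 2 → ℝ → ℝ) (I : Set (Fin 2)) (v : Fin 2 → ℝ) :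
    jointDensity G p pt I v =
      (if i ∈ I then pt i (v i) else p i (v i) (sub (parents G i) v)) *
        if j ∈ I then pt j (v j) else p j (v j) (sub (parents G j) v) := by
  have hu : (Finset.univ : Finset (Fin 2)) = {i, j} := by
    ext m
    simpa using eq_or_eq_of_ne hij m
  rw [jointDensity, hu, Finset.prod_pair hij]

section Models

variable {G : Digraph (Fin 2)} {p : Mechanisms G} {pt : Fin 2 → ℝ → ℝ}

lemma isDensity_rootDensity {i : Fin 2} (hp : IsCondDensity (p i))
    (hpt : IsDensity (pt i)) (I : Set (Fin 2)) : IsDensity (rootDensity G p pt I i) := by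
  unfold rootDensity
  split_ifs
  · exact hpt
  · exact ⟨hp.measurable.comp (measurable_id.prodMk measurable_const), fun x => hp.nonneg x _,
      hp.lintegral_eq_one _⟩

lemma IsRoot.factor_eq {i : Fin 2} (hi : IsRoot G i) (I : Set (Fin 2)) [Decidable (i ∈ I)]
    (v : Fin 2 → ℝ) :
    (if i ∈ I then pt i (v i) else p i (v i) (sub (parents G i) v)) =
      rootDensity G p pt I i (v i) := by
  unfold rootDensity
  split_ifs
  · rfl
  · rw [hi.sub_eq (sub (parents G i) v)]

variable {σ : Equiv.Perm (Fin 2)} {P : Fin 3 → Measure (Fin 2 → ℝ)}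
  [∀ e, IsProbabilityMeasure (P e)]

lemma targets_envOf (i : Fin 2) : targets σ (envOf σ i) = {i} := by
  simp [targets, envOf]

/-- Neither factor involves the other coordinate: a dependence of `j` on `i` is either absent or cut
by the intervention. -/
lemma IsLatentModel.indepFun (hP : IsLatentModel G p pt σ P) {i j : Fin 2} (hij : i ≠ j)
    (hi : IsRoot G i) {e : Fin 3} (hj : j ∈ targets σ e ∨ IsRoot G j) :
    IndepFun (fun v : Fin 2 → ℝ => v i) (fun v => v j) (P e) := by
  classical
  rw [hP.law e]
  refine indepFun_of_factorization hij
    (isDensity_rootDensity (hP.base_density i) (hP.intervened_density i) (targets σ e))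
    (isDensity_rootDensity (hP.base_density j) (hP.intervened_density j) (targets σ e))
    fun v => ?_
  rw [jointDensity_eq_mul hij, hi.factor_eq]
  congr 1
  rcases hj with hj | hj
  · simp [rootDensity, hj]
  · rw [hj.factor_eq]

/-- The marginal law of a root node. -/
lemma IsLatentModel.map_root (hP : IsLatentModel G p pt σ P) {i : Fin 2} (hi : IsRoot G i)
    (e : Fin 3) : (P e).map (fun v : Fin 2 → ℝ => v i) =
      volume.withDensity fun x => ENNReal.ofReal (rootDensity G p pt (targets σ e) i x) := by
  classical
  obtain ⟨j, hij⟩ : ∃ j, i ≠ j := ⟨i + 1, by omega⟩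
  rw [hP.law e]
  -- Only `i` can be a parent of `j`, so the factor of `j` is a density in `y` with parameter `x`
  -- and integrates to one.
  have hsub (x y : ℝ) :
      sub (parents G j) (planeVec i x y) = sub (parents G j) (planeVec i x 0) := by
    ext ⟨m, hm⟩
    have hmi : m = i := (eq_or_eq_of_ne hij m).resolve_right (ne_of_adj hP.acyclic hm)
    simp [sub, hmi]
  refine map_eval_of_factorization i
    (c := fun x y => if j ∈ targets σ e then pt j y
      else p j y (sub (parents G j) (planeVec i x 0)))
    (hP.contDiff e).continuous.measurable
    (isDensity_rootDensity (hP.base_density i) (hP.intervened_density i) (targets σ e))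
    (fun x => ?_) (fun x => ?_) fun x y => ?_
  · split_ifs
    · exact (hP.intervened_density j).lintegral_eq_one
    · exact (hP.base_density j).lintegral_eq_one _
  · split_ifs
    · exact (hP.intervened_density j).measurable
    · exact (hP.base_density j).measurable.comp (measurable_id.prodMk measurable_const)
  · rw [jointDensity_eq_mul hij, hi.factor_eq, planeVec_self, planeVec_of_ne hij, hsub]

lemma IsLatentModel.absolutelyContinuous (hP : IsLatentModel G p pt σ P) (e : Fin 3) :
    P e ≪ volume := by
  rw [hP.law e]
  exact withDensity_absolutelyContinuous _ _

lemma IsLatentModel.volume_absolutelyContinuous (hP : IsLatentModel G p pt σ P) (e : Fin 3) :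
    volume ≪ P e := by
  rw [hP.law e]
  exact withDensity_absolutelyContinuous'
    (hP.contDiff e).continuous.measurable.ennreal_ofReal.aemeasurable
    (Filter.Eventually.of_forall fun v => by simpa using hP.pos e v)

/-- The ratio of the densities in the environment with target `i` and in the observational
environment. -/
noncomputable def densityRatio (G : Digraph (Fin 2)) (p : Mechanisms G) (pt : Fin 2 → ℝ → ℝ)
    (i : Fin 2) (v : Fin 2 → ℝ) : ℝ :=
  jointDensity G p pt {i} v / jointDensity G p pt ∅ v

/-- The intervention on `i` leaves the factor of the other node unchanged, and it cancels. -/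
lemma IsLatentModel.densityRatio_eq (hP : IsLatentModel G p pt σ P) (i : Fin 2)
    (v : Fin 2 → ℝ) :
    densityRatio G p pt i v = pt i (v i) / p i (v i) (sub (parents G i) v) := by
  classical
  obtain ⟨j, hij⟩ : ∃ j, i ≠ j := ⟨i + 1, by omega⟩
  have h0 : 0 < jointDensity G p pt ∅ v := hP.pos 0 v
  rw [densityRatio]
  rw [jointDensity_eq_mul hij] at h0 ⊢
  rw [jointDensity_eq_mul hij]
  simp only [Set.mem_empty_iff_false, if_false, Set.mem_singleton_iff, if_true, hij.symm] at h0 ⊢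
  exact mul_div_mul_right _ _ (right_ne_zero_of_mul h0.ne')

/-- Regularity is assumed for joint densities, whereas single mechanisms are only measurable; this
is why `densityRatio` is built from the former. -/
lemma IsLatentModel.contDiff_densityRatio (hP : IsLatentModel G p pt σ P) (i : Fin 2) :
    ContDiff ℝ 1 (densityRatio G p pt i) := by
  have h1 := hP.contDiff (envOf σ i)
  rw [targets_envOf] at h1
  exact h1.div (hP.contDiff 0) fun v => (hP.pos 0 v).ne'

lemma IsLatentModel.densityRatio_pos (hP : IsLatentModel G p pt σ P) (i : Fin 2)
    (v : Fin 2 → ℝ) : 0 < densityRatio G p pt i v := by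
  have h1 := hP.pos (envOf σ i) v
  rw [targets_envOf] at h1
  exact div_pos h1 (hP.pos 0 v)

lemma IsLatentModel.law_envOf (hP : IsLatentModel G p pt σ P) (i : Fin 2) :
    P (envOf σ i) = (P 0).withDensity fun v => ENNReal.ofReal (densityRatio G p pt i v) := by
  have hm := (hP.contDiff 0).continuous.measurable.ennreal_ofReal
  have hr := (hP.contDiff_densityRatio i).continuous.measurable.ennreal_ofReal
  rw [hP.law, hP.law, ← withDensity_mul _ hm hr, targets_envOf]
  congr 1
  ext v
  rw [Pi.mul_apply, ← ENNReal.ofReal_mul (hP.pos 0 v).le]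
  have hne : jointDensity G p pt ∅ v ≠ 0 := (hP.pos 0 v).ne'
  exact congrArg ENNReal.ofReal (mul_div_cancel₀ _ hne).symm

/-- Density ratios are invariant under a change of coordinates. -/
lemma IsLatentModel.densityRatio_comp (hP : IsLatentModel G p pt σ P)
    {G' : Digraph (Fin 2)} {q : Mechanisms G'} {qt : Fin 2 → ℝ → ℝ} {τ : Equiv.Perm (Fin 2)}
    {Q : Fin 3 → Measure (Fin 2 → ℝ)} [∀ e, IsProbabilityMeasure (Q e)]
    (hQ : IsLatentModel G' q qt τ Q) (Ψ : (Fin 2 → ℝ) ≃ₜ (Fin 2 → ℝ))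
    (hmap : ∀ e, Q e = (P e).map Ψ) (i : Fin 2) (v : Fin 2 → ℝ) :
    densityRatio G p pt i v = densityRatio G' q qt (τ (σ.symm i)) (Ψ v) := by
  have henv : envOf τ (τ (σ.symm i)) = envOf σ i := by simp [envOf]
  have hrP := (hP.contDiff_densityRatio i).continuous
  have hrQ := (hQ.contDiff_densityRatio (τ (σ.symm i))).continuous
  have h1 := hQ.law_envOf (τ (σ.symm i))
  rw [henv, hmap, hmap, hP.law_envOf i] at h1
  have h2 : (P 0).withDensity (fun v => ENNReal.ofReal (densityRatio G p pt i v)) =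
      (P 0).withDensity fun v =>
        ENNReal.ofReal (densityRatio G' q qt (τ (σ.symm i)) (Ψ v)) := by
    ext s hs
    have h3 := congrArg (fun M : Measure (Fin 2 → ℝ) => M (Ψ '' s)) h1
    have hs' : MeasurableSet (Ψ '' s) := Ψ.toMeasurableEquiv.measurableSet_image.2 hs
    simp only [Measure.map_apply Ψ.continuous.measurable hs', Ψ.preimage_image,
      withDensity_apply _ hs'] at h3
    rw [h3, withDensity_apply _ hs, setLIntegral_map hs' hrQ.measurable.ennreal_ofReal
      Ψ.continuous.measurable, Ψ.preimage_image]
  have h4 := (withDensity_eq_iff_of_sigmaFinite hrP.measurable.ennreal_ofReal.aemeasurable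
    (hrQ.comp Ψ.continuous).measurable.ennreal_ofReal.aemeasurable).1 h2
  -- Continuity upgrades almost everywhere equality to equality at every point.
  have h5 := (hP.volume_absolutelyContinuous 0).ae_eq h4
  have h6 := congrFun ((Continuous.ae_eq_iff_eq volume (ENNReal.continuous_ofReal.comp hrP)
    (ENNReal.continuous_ofReal.comp (hrQ.comp Ψ.continuous))).1 h5) v
  exact (ENNReal.ofReal_eq_ofReal_iff (hP.densityRatio_pos i v).le
    (hQ.densityRatio_pos _ _).le).1 h6

end Models

/-! ### Coordinates determined by a function without critical points -/

lemma injective_of_deriv_ne_zero {r : ℝ → ℝ} (hr : ∀ x, deriv r x ≠ 0) :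
    Function.Injective r := by
  have hc : Continuous r := continuous_iff_continuousAt.2 fun x =>
    (differentiableAt_of_deriv_ne_zero (hr x)).continuousAt
  have hlt : ∀ x y, x < y → r x ≠ r y := fun x y hxy h =>
    let ⟨z, _, hz⟩ := exists_deriv_eq_zero hxy hc.continuousOn h
    hr z hz
  intro x y h
  by_contra hne
  rcases lt_or_gt_of_ne hne with h' | h'
  · exact hlt x y h' h
  · exact hlt y x h' h.symm

lemma coord_eq_iff_coord_eq {Ψ : (Fin 2 → ℝ) → Fin 2 → ℝ} (hΨ : Differentiable ℝ Ψ)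
    (hsurj : Function.Surjective Ψ) {r s : ℝ → ℝ} (hr : ∀ x, deriv r x ≠ 0)
    (hs : Differentiable ℝ s) {i a : Fin 2} (h : ∀ v, r (v i) = s (Ψ v a)) (v v' : Fin 2 → ℝ) :
    v i = v' i ↔ Ψ v a = Ψ v' a := by
  -- By surjectivity every `t` is a value of `Ψ · a`. By the chain rule along the `i`-th coordinate
  -- line, a critical point of `s` would give one of `r`.
  have hs' : ∀ t, deriv s t ≠ 0 := by
    intro t h0
    obtain ⟨v, hv⟩ := hsurj fun _ => t
    have hγ : Differentiable ℝ fun x => Ψ (Function.update v i x) a := by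
      intro x
      have h1 := (hΨ (Function.update v i x)).comp x
        (hasDerivAt_update v i x).differentiableAt
      exact differentiableAt_pi.1 h1 a
    have heq : r = s ∘ fun x => Ψ (Function.update v i x) a := by
      ext x
      simpa using h (Function.update v i x)
    apply hr (v i)
    rw [heq, deriv_comp _ (hs _) (hγ _)]
    simp [hv, h0]
  constructor <;> intro hv
  · exact injective_of_deriv_ne_zero hs' (by rw [← h, ← h, hv])
  · exact injective_of_deriv_ne_zero hr (by rw [h, h, hv])

/-! ### Element-wise diffeomorphisms -/

/-- A diffeomorphism of the plane that acts on each coordinate separately, up to a permutation `ρ`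
of the coordinates, is given by diffeomorphisms of the line. -/
lemma exists_diffeomorph_of_elementwise {k : WithTop ℕ∞} {Ψ Φ : (Fin 2 → ℝ) → Fin 2 → ℝ}
    (hΨ : ContDiff ℝ k Ψ) (hΦ : ContDiff ℝ k Φ) (hl : Function.LeftInverse Φ Ψ)
    (hr : Function.RightInverse Φ Ψ) (ρ : Equiv.Perm (Fin 2))
    (helem : ∀ i v v', v i = v' i → Ψ v (ρ i) = Ψ v' (ρ i)) :
    ∃ φ : Fin 2 → Diffeomorph 𝓘(ℝ, ℝ) 𝓘(ℝ, ℝ) ℝ ℝ k, ∀ i v, Ψ v (ρ i) = φ i (v i) := by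
  have helem' : ∀ i w w', w (ρ i) = w' (ρ i) → Φ w i = Φ w' i := by
    intro i w w' hw
    -- Changing only coordinate `i` of `Φ w` affects only coordinate `ρ i` of the image, which then
    -- equals `w' (ρ i) = w (ρ i)`.
    have h1 : Ψ (Function.update (Φ w) i (Φ w' i)) = w := by
      ext m
      obtain ⟨l, rfl⟩ := ρ.surjective m
      by_cases hl : l = i
      · subst hl
        rw [helem l _ (Φ w') (by simp), hr, hw]
      · rw [helem l _ (Φ w) (by simp [hl]), hr]
    have h2 := congrArg (fun u => Φ u i) h1
    simp only [hl _, Function.update_self] at h2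
    exact h2.symm
  have hdiag (g : (Fin 2 → ℝ) → Fin 2 → ℝ) (hg : ContDiff ℝ k g) (m : Fin 2) :
      ContDiff ℝ k fun t : ℝ => g (fun _ => t) m :=
    contDiff_pi.1 (hg.comp (contDiff_pi.2 fun _ => contDiff_id)) m
  -- Each output depends on one input only, so the diagonal `t ↦ (t, t)` recovers the one-variable
  -- maps and keeps their smoothness.
  refine ⟨fun i =>
    { toFun := fun t => Ψ (fun _ => t) (ρ i)
      invFun := fun t => Φ (fun _ => t) i
      left_inv := fun t => ?_
      right_inv := fun t => ?_
      contMDiff_toFun := (hdiag Ψ hΨ (ρ i)).contMDiff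
      contMDiff_invFun := (hdiag Φ hΦ i).contMDiff }, fun i v => helem i _ _ rfl⟩
  · exact (helem' i (fun _ => Ψ (fun _ => t) (ρ i)) (Ψ fun _ => t) rfl).trans (congrFun (hl _) i)
  · exact (helem i (fun _ => Φ (fun _ => t) i) (Φ fun _ => t) rfl).trans (congrFun (hr _) (ρ i))

/-! ### Identifiability of the change of coordinates between two latent models -/

section Identifiability

variable {G : Digraph (Fin 2)} {p : Mechanisms G} {pt : Fin 2 → ℝ → ℝ}
  {σ : Equiv.Perm (Fin 2)} {P : Fin 3 → Measure (Fin 2 → ℝ)} [∀ e, IsProbabilityMeasure (P e)]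
  {G' : Digraph (Fin 2)} {q : Mechanisms G'} {qt : Fin 2 → ℝ → ℝ}
  {τ : Equiv.Perm (Fin 2)} {Q : Fin 3 → Measure (Fin 2 → ℝ)} [∀ e, IsProbabilityMeasure (Q e)]

/-- If `i` is a root of `G` whose counterpart is a root of `G'`, then the change of coordinates is
element-wise. -/
lemma elementwise_of_isRoot (hP : IsLatentModel G p pt σ P) (hdiff : MechanismsDiffer G p pt)
    (hQ : IsLatentModel G' q qt τ Q) (Ψ : (Fin 2 → ℝ) ≃ₜ (Fin 2 → ℝ)) (hΨ : Differentiable ℝ Ψ)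
    (hmap : ∀ e, Q e = (P e).map Ψ) {i : Fin 2} (hi : IsRoot G i)
    (ha : IsRoot G' (τ (σ.symm i))) (m : Fin 2) (v v' : Fin 2 → ℝ) (hm : v m = v' m) :
    Ψ v (τ (σ.symm m)) = Ψ v' (τ (σ.symm m)) := by
  obtain ⟨j, hij⟩ : ∃ j, i ≠ j := ⟨i + 1, by omega⟩
  have hab : τ (σ.symm i) ≠ τ (σ.symm j) := by simpa using hij
  have hroot (v v' : Fin 2 → ℝ) :
      v i = v' i ↔ Ψ v (τ (σ.symm i)) = Ψ v' (τ (σ.symm i)) := by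
    refine coord_eq_iff_coord_eq hΨ Ψ.surjective (r := fun x => pt i x / p i x (sub _ 0))
      (s := fun t => densityRatio G' q qt (τ (σ.symm i)) (fun _ => t)) (fun x => hdiff i x _)
      ?_ (fun v => ?_) v v'
    · exact ((hQ.contDiff_densityRatio _).differentiable one_ne_zero).comp
        (differentiable_pi.2 fun _ => differentiable_id)
    · have h1 := hP.densityRatio_comp hQ Ψ hmap i v
      rw [hP.densityRatio_eq, hi.sub_eq (sub (parents G i) v) (sub _ 0)] at h1
      simp only [h1, hQ.densityRatio_eq, ha.sub_eq (sub (parents G' (τ (σ.symm i))) _) (sub _ 0)]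
  rcases eq_or_eq_of_ne hij m with rfl | rfl
  · exact (hroot v v').1 hm
  have henv : targets τ (envOf σ m) = {τ (σ.symm m)} := by
    rw [← targets_envOf (σ := τ)]
    simp [envOf]
  -- In the environment targeting the non-root candidate `m`, the coordinates are independent in
  -- both models.
  have hindP := hP.indepFun hij hi (e := envOf σ m) (.inl (by rw [targets_envOf]; rfl))
  have hindQ := hQ.indepFun hab ha (e := envOf σ m) (.inl (by rw [henv]; rfl))
  rw [hmap, indepFun_map_iff Ψ.continuous.measurable (measurable_pi_apply _)
    (measurable_pi_apply _)] at hindQ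
  have hindF : IndepFun (fun v : Fin 2 → ℝ => v i) (fun v => Ψ v (τ (σ.symm m)))
      (P (envOf σ m)) := by
    -- By `hroot`, `v i` depends only on the coordinate `τ (σ.symm i)` of `Ψ v`; the diagonal
    -- exhibits it as a continuous function of that coordinate.
    have hγ : Measurable fun t : ℝ => Ψ.symm (fun _ => t) i :=
      ((continuous_apply i).comp (Ψ.symm.continuous.comp
        (continuous_pi fun _ => continuous_id))).measurable
    have hX : (fun v : Fin 2 → ℝ => v i) = (fun t : ℝ => Ψ.symm (fun _ => t) i) ∘
        (fun w : Fin 2 → ℝ => w (τ (σ.symm i))) ∘ Ψ :=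
      funext fun v => (hroot _ _).2 (by simp)
    rw [hX]
    exact hindQ.comp hγ measurable_id
  rw [← planeVec_eta hij v, ← planeVec_eta hij v', hm]
  refine eq_of_indepFun (F := fun v => Ψ v (τ (σ.symm m))) (hP.absolutelyContinuous _)
    (hP.volume_absolutelyContinuous _) hij
    hindP ((continuous_apply _).comp Ψ.continuous) hindF (fun x y y' hy => ?_) _ _ _
  -- A common `v i` fixes one coordinate of `Ψ` and `hy` the other, so injectivity of `Ψ` applies.
  have h1 : Ψ (planeVec i x y) = Ψ (planeVec i x y') := by
    ext l
    rcases eq_or_eq_of_ne hab l with rfl | rfl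
    · exact (hroot _ _).1 (by simp)
    · exact hy
  simpa [planeVec_of_ne hij] using congrFun (Ψ.injective h1) m

/-- Faithfulness gives one direction. Conversely, without the edge both nodes are roots and the
density factorizes. -/
lemma adj_iff_not_indepFun (hP : IsLatentModel G p pt σ P) {i j : Fin 2} (hij : i ≠ j)
    (hi : IsRoot G i) :
    G.Adj i j ↔ ¬ IndepFun (fun v : Fin 2 → ℝ => v i) (fun v => v j) (P 0) := by
  refine ⟨fun h => hP.faithful.not_indepFun hP.acyclic h, fun h => ?_⟩
  by_contra hadj
  exact h (hP.indepFun hij hi (.inr ((isRoot_or_adj hP.acyclic hij.symm).resolve_right hadj)))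

/-- Under genericity, some root of `G` has a root of `G'` as its counterpart. -/
lemma exists_isRoot_isRoot (hP : IsLatentModel G p pt σ P) (hgen : Generic G p pt σ P)
    (hQ : IsLatentModel G' q qt τ Q) (Ψ : (Fin 2 → ℝ) ≃ₜ (Fin 2 → ℝ))
    (hmap : ∀ e, Q e = (P e).map Ψ) : ∃ i, IsRoot G i ∧ IsRoot G' (τ (σ.symm i)) := by
  by_contra! hno
  obtain ⟨i, hi⟩ : ∃ i, IsRoot G i := by
    rcases isRoot_or_adj hP.acyclic (zero_ne_one (α := Fin 2)) with h | h
    · exact ⟨0, h⟩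
    · exact ⟨1, isRoot_of_adj hP.acyclic h⟩
  obtain ⟨j, hij⟩ : ∃ j, i ≠ j := ⟨i + 1, by omega⟩
  have hab : τ (σ.symm i) ≠ τ (σ.symm j) := by simpa using hij
  have hb : IsRoot G' (τ (σ.symm j)) :=
    isRoot_of_adj hQ.acyclic ((isRoot_or_adj hQ.acyclic hab).resolve_left (hno i hi))
  have hadj : G.Adj i j :=
    (isRoot_or_adj hP.acyclic hij.symm).resolve_left fun h => hno j h hb
  obtain ⟨φ, hφ, -, -, hne⟩ := hgen i j hadj
  apply hne
  -- `φ` is continuous only on `(0, ∞)`, where the ratio takes its values; the diagonal is harmless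
  -- because the node is a root.
  have hs : Continuous fun t => φ (densityRatio G' q qt (τ (σ.symm j)) fun _ => t) :=
    hφ.comp_continuous ((hQ.contDiff_densityRatio _).continuous.comp
      (continuous_pi fun _ => continuous_id)) fun t => hQ.densityRatio_pos _ _
  have hintegral (e : Fin 3) : ∫ v, φ (pt j (v j) / p j (v j) (sub (parents G j) v)) ∂(P e) =
      ∫ t, φ (densityRatio G' q qt (τ (σ.symm j)) fun _ => t)
        ∂((Q e).map fun w => w (τ (σ.symm j))) := by
    have hm := measurable_pi_apply (X := fun _ : Fin 2 => ℝ) (τ (σ.symm j))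
    rw [hmap, Measure.map_map hm Ψ.continuous.measurable,
      integral_map (hm.comp Ψ.continuous.measurable).aemeasurable hs.aestronglyMeasurable]
    refine integral_congr_ae (.of_forall fun v => ?_)
    simp only [← hP.densityRatio_eq, hP.densityRatio_comp hQ Ψ hmap]
    rw [hQ.densityRatio_eq, hQ.densityRatio_eq,
      hb.sub_eq (sub _ (Ψ v)) (sub _ fun _ => Ψ v (τ (σ.symm j)))]
    rfl
  have henv : targets τ (envOf σ i) = {τ (σ.symm i)} := by
    rw [← targets_envOf (σ := τ)]
    simp [envOf]
  -- The intervention hits the other node, so the law of this root coordinate is the same in both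
  -- environments.
  rw [hintegral, hintegral, hQ.map_root hb, hQ.map_root hb, henv]
  simp [rootDensity, targets, hij.symm]

end Identifiability

end CRL

/-! ### Main theorem: identifiability for two nodes -/

theorem mainTheorem1 {d : ℕ} (k : WithTop ℕ∞) (hk : 1 ≤ k)
    -- ground truth: mixing, graph, mechanisms, intervention targets, latent laws
    (f : (Fin 2 → ℝ) → Fin d → ℝ) (finv : (Fin d → ℝ) → Fin 2 → ℝ)
    (hf : CRL.IsDiffeoOntoImage k f finv)
    (G : Digraph (Fin 2)) (p : CRL.Mechanisms G) (pt : Fin 2 → ℝ → ℝ)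
    (σ : Equiv.Perm (Fin 2)) (P : Fin 3 → MeasureTheory.Measure (Fin 2 → ℝ))
    [∀ e, MeasureTheory.IsProbabilityMeasure (P e)]
    (hP : CRL.IsLatentModel G p pt σ P)
    (hdiff : CRL.MechanismsDiffer G p pt)
    (hgen : CRL.Generic G p pt σ P)
    -- candidate: encoder with its inverse, graph, mechanisms, intervention targets, latent laws
    (h : (Fin d → ℝ) → Fin 2 → ℝ) (hinv : (Fin 2 → ℝ) → Fin d → ℝ)
    (hh : CRL.IsDiffeoOntoImage k hinv h) (hrange : Set.range hinv = Set.range f)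
    (G' : Digraph (Fin 2)) (q : CRL.Mechanisms G') (qt : Fin 2 → ℝ → ℝ)
    (τ : Equiv.Perm (Fin 2)) (Q : Fin 3 → MeasureTheory.Measure (Fin 2 → ℝ))
    [∀ e, MeasureTheory.IsProbabilityMeasure (Q e)]
    (hpush : ∀ e, Q e = ((P e).map f).map h)
    (hQ : CRL.IsLatentModel G' q qt τ Q) :
    CRL.CRLEquiv k (Set.range f) finv G h G' := by
  have hΨ : ContDiff ℝ k (h ∘ f) := by
    have := hh.contDiffOn_inv
    rw [hrange] at this
    exact this.comp_contDiff hf.contDiff fun v => ⟨v, rfl⟩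
  have hΦ : ContDiff ℝ k (finv ∘ hinv) :=
    hf.contDiffOn_inv.comp_contDiff hh.contDiff fun w => hrange ▸ ⟨w, rfl⟩
  have hl : Function.LeftInverse (finv ∘ hinv) (h ∘ f) := by
    intro v
    obtain ⟨w, hw⟩ : f v ∈ Set.range hinv := hrange ▸ ⟨v, rfl⟩
    simp only [Function.comp_apply, ← hw, hh.leftInverse w]
    rw [hw, hf.leftInverse v]
  have hr : Function.RightInverse (finv ∘ hinv) (h ∘ f) := by
    intro w
    obtain ⟨v, hv⟩ : hinv w ∈ Set.range f := hrange ▸ ⟨w, rfl⟩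
    simp only [Function.comp_apply, ← hv, hf.leftInverse v]
    rw [hv, hh.leftInverse w]
  let Ψ : (Fin 2 → ℝ) ≃ₜ (Fin 2 → ℝ) :=
    ⟨⟨h ∘ f, finv ∘ hinv, hl, hr⟩, hΨ.continuous, hΦ.continuous⟩
  have hmap (e : Fin 3) : Q e = (P e).map Ψ := by
    -- `h` is arbitrary off the image. The push-forward along a map that is not a.e. measurable is
    -- zero by convention, so the probability measure `Q e` supplies a.e. measurability.
    have hne : ((P e).map f).map h ≠ 0 := hpush e ▸ IsProbabilityMeasure.ne_zero (Q e)
    rw [hpush e, AEMeasurable.map_map_of_aemeasurable (.of_map_ne_zero hne)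
      hf.contDiff.continuous.measurable.aemeasurable]
    rfl
  obtain ⟨i, hi, ha⟩ := CRL.exists_isRoot_isRoot hP hgen hQ Ψ hmap
  have hdΨ : Differentiable ℝ Ψ := hΨ.differentiable (by rintro rfl; simp at hk)
  obtain ⟨φ, hφ⟩ := CRL.exists_diffeomorph_of_elementwise hΨ hΦ hl hr (σ.symm.trans τ)
    (CRL.elementwise_of_isRoot hP hdiff hQ Ψ hdΨ hmap hi ha)
  refine ⟨σ.symm.trans τ, φ, ?_, ?_⟩
  · rintro _ ⟨v, rfl⟩
    ext m
    obtain ⟨l, rfl⟩ := (σ.symm.trans τ).surjective m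
    rw [Matrix.permMatrix_mulVec, hf.leftInverse]
    simpa using hφ l v
  · obtain ⟨j, hij⟩ : ∃ j, i ≠ j := ⟨i + 1, by omega⟩
    have hab : τ (σ.symm i) ≠ τ (σ.symm j) := by simpa using hij
    have hφm (m : Fin 2) : Measurable (φ m) := (φ m).continuous.measurable
    have hφm' (m : Fin 2) : Measurable (φ m).symm := (φ m).symm.continuous.measurable
    have hindep : IndepFun (fun v : Fin 2 → ℝ => v i) (fun v => v j) (P 0) ↔
        IndepFun (fun w : Fin 2 → ℝ => w (τ (σ.symm i))) (fun w => w (τ (σ.symm j))) (Q 0) := by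
      rw [hmap, CRL.indepFun_map_iff Ψ.continuous.measurable (measurable_pi_apply _)
        (measurable_pi_apply _)]
      have hcomp (m : Fin 2) :
          (fun w : Fin 2 → ℝ => w (τ (σ.symm m))) ∘ Ψ = φ m ∘ fun v => v m :=
        funext fun v => hφ m v
      rw [hcomp, hcomp]
      refine ⟨fun H => H.comp (hφm i) (hφm j), fun H => ?_⟩
      convert H.comp (hφm' i) (hφm' j) using 1 <;> ext v <;> simp
    have hedge : G.Adj i j ↔ G'.Adj (τ (σ.symm i)) (τ (σ.symm j)) := by
      rw [CRL.adj_iff_not_indepFun hP hij hi, CRL.adj_iff_not_indepFun hQ hab ha, hindep]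
    -- Since `i` and its counterpart are roots, `i → j` is the only edge left to compare.
    intro l m
    rcases CRL.eq_or_eq_of_ne hij m with rfl | rfl
    · exact iff_of_false (hi l) (ha _)
    rcases CRL.eq_or_eq_of_ne hij l with rfl | rfl
    · exact hedge
    · exact iff_of_false (fun H => CRL.ne_of_adj hP.acyclic H rfl)
        fun H => CRL.ne_of_adj hQ.acyclic H rfl
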